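/- Consider the linear time-invariant plant $$\dot x = A x + B_1 w + B u,\qquad z = C_1 x + D_{11} w + D_{12} u,\qquad y = C x + D_{21} w,$$ with real matrices and $x\in\mathbb R^{n_x}$, $w\in\mathbb R^{n_w}$, $u\in\mathbb R^{n_u}$, $z\in\mathbb R^{n_z}$, $y\in\mathbb R^{n_y}$. Let $E_1,\dots,E_l\in\{0,1\}^{n_u\times n_y}$ be fixed binary matrices, and for $h\in\mathbb R^l$ let $K(h)=\sum_{i=1}^l h_iE_i$. The feedback $u=K(h)y$ gives the closed loop $\dot x=A_{\rm cl}(h)x+B_{\rm cl}(h)w$, $z=C_{\rm cl}(h)x+D_{\rm cl}(h)w$ with $$A_{\rm cl}(h)=A+BK(h)C,\quad B_{\rm cl}(h)=B_1+BK(h)D_{21},\quad C_{\rm cl}(h)=C_1+D_{12}K(h)C,\quad D_{\rm cl}(h)=D_{11}+D_{12}K(h)D_{21}.$$ The gain $K(h)$ is called stabilizing if all eigenvalues of $A_{\rm cl}(h)$ have negative real part. The closed-loop $\mathcal H_\infty$ norm is $$\|G_{\rm cl}(h)\|_{\mathcal H_\infty}=\sup_{\operatorname{Re}s>0}\sigma_{\max}\bigl(C_{\rm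 cl}(h)(sI-A_{\rm cl}(h))^{-1}B_{\rm cl}(h)+D_{\rm cl}(h)\bigr).$$ Assume that $D_{21}=0$, $D_{11}\neq 0$ and $B_1B_1^\top\succ 0$. Consider the problem of minimizing $\gamma$ over all symmetric $Q\in\mathbb R^{n_x\times n_x}$, $h\in\mathbb R^l$ and $\gamma\in\mathbb R$ subject to $g_{\rm LMI}(Q,\gamma)+g_{\rm BMI}(Q,h)\preceq 0$, where, with $\ast$ denoting the blocks determined by symmetry, $$g_{\rm LMI}(Q,\gamma)=\begin{bmatrix}-Q&0&0&0\\ \ast&AQ+QA^\top&(C_1Q)^\top&B_1\\ \ast&\ast&-\gamma I&D_{11}\\ \ast&\ast&\ast&-\gamma I\end{bmatrix},$$ $$g_{\rm BMI}(Q,h)=\begin{bmatrix}0&0&0&0\\ \ast&BK(h)CQ+(BK(h)CQ)^\top&(D_{12}K(h)CQ)^\top&0\\ \ast&\ast&0&0\\ \ast&\ast&\ast&0\end{bmatrix}.$$ If $(Q^\ast,h^\ast,\gamma^\ast)$ is an optimal solution of this problem, then $\gamma^\ast>0$, the gain $K(h^\ast)$ is stabilizing, and $\|G_{\rm cl}(h^\ast)\|_{\mathcal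 H_\infty}\le\|G_{\rm cl}(h)\|_{\mathcal H_\infty}$ for every $h\in\mathbb R^l$ such that $K(h)$ is stabilizing. -/

import Mathlib

open Matrix
open scoped ENNReal

/-- The data of a linear time-invariant plant
`ẋ = A x + B₁ w + B u`, `z = C₁ x + D₁₁ w + D₁₂ u`, `y = C x + D₂₁ w`,
with state `x ∈ ℝ^nx`, input `w ∈ ℝ^nw`, command `u ∈ ℝ^nu`, response `z ∈ ℝ^nz` and
measurement `y ∈ ℝ^ny`. -/
structure Plant (nx nw nu nz ny : ℕ) where
  A : Matrix (Fin nx) (Fin nx) ℝ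
  B₁ : Matrix (Fin nx) (Fin nw) ℝ
  B : Matrix (Fin nx) (Fin nu) ℝ
  C₁ : Matrix (Fin nz) (Fin nx) ℝ
  C : Matrix (Fin ny) (Fin nx) ℝ
  D₁₁ : Matrix (Fin nz) (Fin nw) ℝ
  D₁₂ : Matrix (Fin nz) (Fin nu) ℝ
  D₂₁ : Matrix (Fin ny) (Fin nw) ℝ

/-- The structured gain `K(h) = ∑ i, h i • E i`. -/
def structuredGain {nu ny l : ℕ} (E : Fin l → Matrix (Fin nu) (Fin ny) ℝ) (h : Fin l → ℝ) :
    Matrix (Fin nu) (Fin ny) ℝ :=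
  ∑ i, h i • E i

/-- A real square matrix all of whose complex eigenvalues have negative real part. -/
def IsHurwitz {n : ℕ} (M : Matrix (Fin n) (Fin n) ℝ) : Prop :=
  ∀ μ : ℂ, Module.End.HasEigenvalue (Matrix.toLin' (M.map (algebraMap ℝ ℂ))) μ → μ.re < 0

/-- The transfer matrix `C (s I - A)⁻¹ B + D` of `ẋ = A x + B w`, `z = C x + D w`. -/
noncomputable def transferMatrix {n m p : ℕ} (A : Matrix (Fin n) (Fin n) ℝ)
    (B : Matrix (Fin n) (Fin m) ℝ) (C : Matrix (Fin p) (Fin n) ℝ)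
    (D : Matrix (Fin p) (Fin m) ℝ) (s : ℂ) : Matrix (Fin p) (Fin m) ℂ :=
  C.map (algebraMap ℝ ℂ) * (s • (1 : Matrix (Fin n) (Fin n) ℂ) - A.map (algebraMap ℝ ℂ))⁻¹
    * B.map (algebraMap ℝ ℂ) + D.map (algebraMap ℝ ℂ)

open scoped Matrix.Norms.L2Operator in
/-- The `H∞` norm of a matrix-valued function on the open right half-plane: the supremum over
`Re s > 0` of the spectral norm (largest singular value) of `G s`, as an extended nonnegative
real. -/
noncomputable def hInfNorm {p m : ℕ} (G : ℂ → Matrix (Fin p) (Fin m) ℂ) : ℝ≥0∞ :=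
  ⨆ s : ℂ, ⨆ _ : 0 < s.re, ENNReal.ofReal ‖G s‖

namespace Plant

variable {nx nw nu nz ny l : ℕ}

/-! The closed loop obtained with `u = K(h) y`. -/

/-- `A_cl(h) = A + B K(h) C`. -/
def Acl (P : Plant nx nw nu nz ny) (E : Fin l → Matrix (Fin nu) (Fin ny) ℝ) (h : Fin l → ℝ) :
    Matrix (Fin nx) (Fin nx) ℝ :=
  P.A + P.B * structuredGain E h * P.C

/-- `B_cl(h) = B₁ + B K(h) D₂₁`. -/
def Bcl (P : Plant nx nw nu nz ny) (E : Fin l → Matrix (Fin nu) (Fin ny) ℝ) (h : Fin l → ℝ) :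
    Matrix (Fin nx) (Fin nw) ℝ :=
  P.B₁ + P.B * structuredGain E h * P.D₂₁

/-- `C_cl(h) = C₁ + D₁₂ K(h) C`. -/
def Ccl (P : Plant nx nw nu nz ny) (E : Fin l → Matrix (Fin nu) (Fin ny) ℝ) (h : Fin l → ℝ) :
    Matrix (Fin nz) (Fin nx) ℝ :=
  P.C₁ + P.D₁₂ * structuredGain E h * P.C

/-- `D_cl(h) = D₁₁ + D₁₂ K(h) D₂₁`. -/
def Dcl (P : Plant nx nw nu nz ny) (E : Fin l → Matrix (Fin nu) (Fin ny) ℝ) (h : Fin l → ℝ) :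
    Matrix (Fin nz) (Fin nw) ℝ :=
  P.D₁₁ + P.D₁₂ * structuredGain E h * P.D₂₁

/-- `K(h)` stabilizes the plant. -/
def IsStabilizing (P : Plant nx nw nu nz ny) (E : Fin l → Matrix (Fin nu) (Fin ny) ℝ)
    (h : Fin l → ℝ) : Prop :=
  IsHurwitz (P.Acl E h)

/-- The `H∞` norm of the closed loop from `w` to `z` (meaningful when `K(h)` is stabilizing). -/
noncomputable def closedLoopHInfNorm (P : Plant nx nw nu nz ny)
    (E : Fin l → Matrix (Fin nu) (Fin ny) ℝ) (h : Fin l → ℝ) : ℝ≥0∞ :=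
  hInfNorm (transferMatrix (P.Acl E h) (P.Bcl E h) (P.Ccl E h) (P.Dcl E h))

/-- `K(h)` is an `H∞`-optimal structured static output-feedback gain: it stabilizes the plant, and
its closed-loop `H∞` norm is least among all stabilizing gains `K(h')`, `h' ∈ ℝ^l`. -/
def IsHInfOptimal (P : Plant nx nw nu nz ny) (E : Fin l → Matrix (Fin nu) (Fin ny) ℝ)
    (h : Fin l → ℝ) : Prop :=
  P.IsStabilizing E h ∧
    ∀ h' : Fin l → ℝ, P.IsStabilizing E h' → P.closedLoopHInfNorm E h ≤ P.closedLoopHInfNorm E h'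

/-- The index type of the `(2 nx + nz + nw)`-dimensional block matrices of the `H∞` problem, in
the block order `nx, nx, nz, nw`. -/
abbrev BlockIndex (nx nz nw : ℕ) : Type :=
  (Fin nx ⊕ Fin nx) ⊕ (Fin nz ⊕ Fin nw)

/-- The symmetric matrix
`[-Q, 0, 0, 0; *, A Q + Q Aᵀ, (C₁ Q)ᵀ, B₁; *, *, -γ I, D₁₁; *, *, *, -γ I]`. -/
def gLMI (P : Plant nx nw nu nz ny) (Q : Matrix (Fin nx) (Fin nx) ℝ) (γ : ℝ) :
    Matrix (BlockIndex nx nz nw) (BlockIndex nx nz nw) ℝ :=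
  fromBlocks
    (fromBlocks
      (-Q) 0
      0 (P.A * Q + Q * P.Aᵀ))
    (fromBlocks
      0 0
      (P.C₁ * Q)ᵀ P.B₁)
    (fromBlocks
      0 (P.C₁ * Q)
      0 P.B₁ᵀ)
    (fromBlocks
      (-(γ • (1 : Matrix (Fin nz) (Fin nz) ℝ))) P.D₁₁
      P.D₁₁ᵀ (-(γ • (1 : Matrix (Fin nw) (Fin nw) ℝ))))

/-- The symmetric matrix
`[0, 0, 0, 0; *, B K(h) C Q + (B K(h) C Q)ᵀ, (D₁₂ K(h) C Q)ᵀ, 0; *, *, 0, 0; *, *, *, 0]`. -/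
def gBMI (P : Plant nx nw nu nz ny) (E : Fin l → Matrix (Fin nu) (Fin ny) ℝ)
    (Q : Matrix (Fin nx) (Fin nx) ℝ) (h : Fin l → ℝ) :
    Matrix (BlockIndex nx nz nw) (BlockIndex nx nz nw) ℝ :=
  fromBlocks
    (fromBlocks
      0 0
      0 (P.B * structuredGain E h * P.C * Q + (P.B * structuredGain E h * P.C * Q)ᵀ))
    (fromBlocks
      0 0
      (P.D₁₂ * structuredGain E h * P.C * Q)ᵀ 0)
    (fromBlocks
      0 (P.D₁₂ * structuredGain E h * P.C * Q)
      0 0)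
    0

/-- Feasibility of `(Q, h, γ)` for the `H∞` BMI problem: `Q` is symmetric and
`gLMI(Q, γ) + gBMI(Q, h) ⪯ 0`. -/
def IsFeasible (P : Plant nx nw nu nz ny) (E : Fin l → Matrix (Fin nu) (Fin ny) ℝ)
    (Q : Matrix (Fin nx) (Fin nx) ℝ) (h : Fin l → ℝ) (γ : ℝ) : Prop :=
  Q.IsSymm ∧ (-(P.gLMI Q γ + P.gBMI E Q h)).PosSemidef

/-- `(Q, h, γ)` is an optimal solution (global minimizer) of the `H∞` BMI problem: minimize `γ`
over all feasible triples. -/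
def IsOptimalSolution (P : Plant nx nw nu nz ny) (E : Fin l → Matrix (Fin nu) (Fin ny) ℝ)
    (Q : Matrix (Fin nx) (Fin nx) ℝ) (h : Fin l → ℝ) (γ : ℝ) : Prop :=
  P.IsFeasible E Q h γ ∧
    ∀ (Q' : Matrix (Fin nx) (Fin nx) ℝ) (h' : Fin l → ℝ) (γ' : ℝ),
      P.IsFeasible E Q' h' γ' → γ ≤ γ'

end Plant

/-! Since D₂₁ = 0, the constraint is the bounded real inequality of the closed loop. For γ > 0,
eliminating the `w` block shows that it holds exactly when Q ⪰ 0 and `DissipationInequality` holds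
for R = γQ. A nonzero entry of D₁₁ forces γ > 0. Feasibility gives stability and the norm bound: if
A*x = s x, the inequality reads 2 Re(s) x*Rx + |B₁ᵀx|² ≤ 0, and B₁B₁ᵀ ≻ 0 excludes Re s ≥ 0 even
though R is only semidefinite. Evaluated along frequency-domain states it gives ‖G(s)‖ ≤ γ.
Conversely, a stabilizing gain with norm at most γ₀ is feasible at every level γ > γ₀
(`IsHurwitz.exists_dissipationInequality`), so a gain better than h* would contradict minimality.
This converse is proved by duality. If no symmetric R works, Hahn-Banach yields a nonzero W = [F; N]
with G Fᵀ skew, where G = AᵀF + CᵀN, and with output energy at least γ² tr NᵀN. Skewness splits the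
columns into signals of purely imaginary frequency and signals with zero state, whose gains are
G(iω) and D = G(∞), both at most γ₀. Hence N = 0, then F = 0, a contradiction. Positivity of R
follows separately from Lyapunov's theorem. -/

/-! ### The block matrix constraint as a dissipation inequality. -/

section DissipationInequality

variable {n m p : ℕ}

/-- The matrix inequality of the bounded real lemma, in dual (controllability) form, written as an
inequality between quadratic forms. -/
def DissipationInequality (A : Matrix (Fin n) (Fin n) ℝ) (B : Matrix (Fin n) (Fin m) ℝ)
    (C : Matrix (Fin p) (Fin n) ℝ) (D : Matrix (Fin p) (Fin m) ℝ)
    (R : Matrix (Fin n) (Fin n) ℝ) (γ : ℝ) : Prop :=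
  ∀ (x : Fin n → ℝ) (u : Fin p → ℝ),
    2 * ((Aᵀ *ᵥ x + Cᵀ *ᵥ u) ⬝ᵥ (R *ᵥ x))
      + (Bᵀ *ᵥ x + Dᵀ *ᵥ u) ⬝ᵥ (Bᵀ *ᵥ x + Dᵀ *ᵥ u) ≤ γ ^ 2 * (u ⬝ᵥ u)

/-- The negative of the constraint matrix of the `H∞` problem for the system `(A, B, C, D)`. -/
def boundedRealMatrix (A : Matrix (Fin n) (Fin n) ℝ) (B : Matrix (Fin n) (Fin m) ℝ)
    (C : Matrix (Fin p) (Fin n) ℝ) (D : Matrix (Fin p) (Fin m) ℝ)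
    (Q : Matrix (Fin n) (Fin n) ℝ) (γ : ℝ) :
    Matrix (Plant.BlockIndex n p m) (Plant.BlockIndex n p m) ℝ :=
  fromBlocks
    (fromBlocks Q 0 0 (-(A * Q + Q * Aᵀ)))
    (fromBlocks 0 0 (-(C * Q)ᵀ) (-B))
    (fromBlocks 0 (-(C * Q)) 0 (-Bᵀ))
    (fromBlocks (γ • 1) (-D) (-Dᵀ) (γ • 1))

theorem boundedRealMatrix_quadraticForm (A : Matrix (Fin n) (Fin n) ℝ)
    (B : Matrix (Fin n) (Fin m) ℝ) (C : Matrix (Fin p) (Fin n) ℝ) (D : Matrix (Fin p) (Fin m) ℝ)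
    {Q : Matrix (Fin n) (Fin n) ℝ} (hQ : Q.IsSymm) (γ : ℝ)
    (a x : Fin n → ℝ) (u : Fin p → ℝ) (w : Fin m → ℝ) :
    Sum.elim (Sum.elim a x) (Sum.elim u w) ⬝ᵥ
        (boundedRealMatrix A B C D Q γ *ᵥ Sum.elim (Sum.elim a x) (Sum.elim u w)) =
      a ⬝ᵥ (Q *ᵥ a) - 2 * ((Aᵀ *ᵥ x + Cᵀ *ᵥ u) ⬝ᵥ (Q *ᵥ x))
        - 2 * (w ⬝ᵥ (Bᵀ *ᵥ x + Dᵀ *ᵥ u)) + γ * (u ⬝ᵥ u + w ⬝ᵥ w) := by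
  have e1 : x ⬝ᵥ (A * Q) *ᵥ x = (Aᵀ *ᵥ x) ⬝ᵥ (Q *ᵥ x) := by
    rw [← mulVec_mulVec, dotProduct_mulVec, ← mulVec_transpose]
  have e2 : x ⬝ᵥ (Q * Aᵀ) *ᵥ x = (Aᵀ *ᵥ x) ⬝ᵥ (Q *ᵥ x) := by
    rw [← mulVec_mulVec, dotProduct_mulVec, ← mulVec_transpose, hQ.eq, dotProduct_comm]
  have e3 : u ⬝ᵥ (C * Q) *ᵥ x = (Cᵀ *ᵥ u) ⬝ᵥ (Q *ᵥ x) := by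
    rw [← mulVec_mulVec, dotProduct_mulVec, ← mulVec_transpose]
  have e4 : x ⬝ᵥ (C * Q)ᵀ *ᵥ u = (Cᵀ *ᵥ u) ⬝ᵥ (Q *ᵥ x) := by
    rw [mulVec_transpose, dotProduct_comm, ← dotProduct_mulVec, e3]
  have e5 : x ⬝ᵥ B *ᵥ w = w ⬝ᵥ (Bᵀ *ᵥ x) := by
    rw [mulVec_transpose, dotProduct_comm w, ← dotProduct_mulVec]
  have e6 : u ⬝ᵥ D *ᵥ w = w ⬝ᵥ (Dᵀ *ᵥ u) := by
    rw [mulVec_transpose, dotProduct_comm w, ← dotProduct_mulVec]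
  simp only [boundedRealMatrix, fromBlocks_mulVec, Sum.elim_comp_inl, Sum.elim_comp_inr,
    sumElim_dotProduct_sumElim, dotProduct_add, add_dotProduct, neg_mulVec, add_mulVec,
    zero_mulVec, dotProduct_neg, dotProduct_zero, smul_mulVec, one_mulVec, dotProduct_smul,
    smul_eq_mul, e1, e2, e3, e4, e5, e6, zero_add, add_zero]
  ring

theorem boundedRealMatrix_isSymm (A : Matrix (Fin n) (Fin n) ℝ)
    (B : Matrix (Fin n) (Fin m) ℝ) (C : Matrix (Fin p) (Fin n) ℝ) (D : Matrix (Fin p) (Fin m) ℝ)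
    {Q : Matrix (Fin n) (Fin n) ℝ} (hQ : Q.IsSymm) (γ : ℝ) :
    (boundedRealMatrix A B C D Q γ).IsSymm := by
  simp only [boundedRealMatrix, IsSymm, fromBlocks_transpose, transpose_neg, transpose_add,
    transpose_mul, transpose_transpose, hQ.eq, transpose_zero, transpose_smul, transpose_one,
    add_comm]

theorem boundedRealMatrix_posSemidef_iff (A : Matrix (Fin n) (Fin n) ℝ)
    (B : Matrix (Fin n) (Fin m) ℝ) (C : Matrix (Fin p) (Fin n) ℝ) (D : Matrix (Fin p) (Fin m) ℝ)
    {Q : Matrix (Fin n) (Fin n) ℝ} (hQ : Q.IsSymm) (γ : ℝ) :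
    (boundedRealMatrix A B C D Q γ).PosSemidef ↔
      ∀ (a x : Fin n → ℝ) (u : Fin p → ℝ) (w : Fin m → ℝ),
        0 ≤ a ⬝ᵥ (Q *ᵥ a) - 2 * ((Aᵀ *ᵥ x + Cᵀ *ᵥ u) ⬝ᵥ (Q *ᵥ x))
          - 2 * (w ⬝ᵥ (Bᵀ *ᵥ x + Dᵀ *ᵥ u)) + γ * (u ⬝ᵥ u + w ⬝ᵥ w) := by
  constructor
  · intro h a x u w
    rw [← boundedRealMatrix_quadraticForm A B C D hQ]
    simpa using h.dotProduct_mulVec_nonneg (Sum.elim (Sum.elim a x) (Sum.elim u w))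
  · intro h
    refine PosSemidef.of_dotProduct_mulVec_nonneg
      (by rw [IsHermitian, conjTranspose_eq_transpose_of_trivial]
          exact boundedRealMatrix_isSymm A B C D hQ γ) fun v => ?_
    have hv : v = Sum.elim (Sum.elim (fun i => v (.inl (.inl i))) (fun i => v (.inl (.inr i))))
        (Sum.elim (fun i => v (.inr (.inl i))) (fun i => v (.inr (.inr i)))) := by
      ext i; rcases i with (i | i) | (i | i) <;> rfl
    rw [star_trivial, hv, boundedRealMatrix_quadraticForm A B C D hQ]
    exact h _ _ _ _

variable {A : Matrix (Fin n) (Fin n) ℝ} {B : Matrix (Fin n) (Fin m) ℝ}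
  {C : Matrix (Fin p) (Fin n) ℝ} {D : Matrix (Fin p) (Fin m) ℝ} {Q R : Matrix (Fin n) (Fin n) ℝ}
  {γ : ℝ}

/-- A 2×2 principal submatrix with diagonal γ and off-diagonal entry -D i j must be positive
semidefinite. This is the source of γ > 0. -/
theorem abs_le_of_boundedRealMatrix_posSemidef (hQ : Q.IsSymm)
    (h : (boundedRealMatrix A B C D Q γ).PosSemidef) (i : Fin p) (j : Fin m) : |D i j| ≤ γ := by
  rw [boundedRealMatrix_posSemidef_iff A B C D hQ] at h
  have h1 := h 0 0 (Pi.single i 1) (Pi.single j 1)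
  have h2 := h 0 0 (Pi.single i 1) (-Pi.single j 1)
  simp at h1 h2
  rw [abs_le]
  constructor <;> linarith

theorem posSemidef_of_boundedRealMatrix_posSemidef (hQ : Q.IsSymm)
    (h : (boundedRealMatrix A B C D Q γ).PosSemidef) : Q.PosSemidef := by
  rw [boundedRealMatrix_posSemidef_iff A B C D hQ] at h
  refine PosSemidef.of_dotProduct_mulVec_nonneg
    (by rw [IsHermitian, conjTranspose_eq_transpose_of_trivial]; exact hQ) fun a => ?_
  simpa using h a 0 0 0

theorem dissipationInequality_of_boundedRealMatrix_posSemidef (hQ : Q.IsSymm) (hγ : 0 < γ)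
    (h : (boundedRealMatrix A B C D Q γ).PosSemidef) :
    DissipationInequality A B C D (γ • Q) γ := by
  rw [boundedRealMatrix_posSemidef_iff A B C D hQ] at h
  intro x u
  -- This w minimizes the form, so substituting it takes the Schur complement of the last block.
  have h1 := h 0 x u (γ⁻¹ • (Bᵀ *ᵥ x + Dᵀ *ᵥ u))
  generalize Bᵀ *ᵥ x + Dᵀ *ᵥ u = y at *
  simp only [smul_dotProduct, dotProduct_smul, zero_dotProduct, smul_mulVec, smul_eq_mul] at h1 ⊢
  have h2 := mul_nonneg hγ.le h1
  have e : γ * (0 - 2 * ((Aᵀ *ᵥ x + Cᵀ *ᵥ u) ⬝ᵥ Q *ᵥ x) - 2 * (γ⁻¹ * (y ⬝ᵥ y)) +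
      γ * (u ⬝ᵥ u + γ⁻¹ * (γ⁻¹ * (y ⬝ᵥ y)))) =
      γ ^ 2 * (u ⬝ᵥ u) - 2 * (γ * ((Aᵀ *ᵥ x + Cᵀ *ᵥ u) ⬝ᵥ Q *ᵥ x)) - y ⬝ᵥ y := by
    field_simp
    ring
  linarith

theorem DissipationInequality.boundedRealMatrix_posSemidef (hγ : 0 < γ) (hR : R.PosSemidef)
    (h : DissipationInequality A B C D R γ) :
    (boundedRealMatrix A B C D (γ⁻¹ • R) γ).PosSemidef := by
  have hs : (γ⁻¹ • R).IsSymm := by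
    have := hR.1
    rw [IsHermitian, conjTranspose_eq_transpose_of_trivial] at this
    rw [IsSymm, transpose_smul, this]
  rw [boundedRealMatrix_posSemidef_iff A B C D hs]
  intro a x u w
  have h1 := h x u
  have h2 : 0 ≤ a ⬝ᵥ R *ᵥ a := by simpa using hR.dotProduct_mulVec_nonneg a
  generalize Bᵀ *ᵥ x + Dᵀ *ᵥ u = y at *
  -- Completing the square in w reverses the elimination.
  have h3 : 0 ≤ (γ • w - y) ⬝ᵥ (γ • w - y) := by
    simpa using dotProduct_star_self_nonneg (γ • w - y)
  simp only [smul_dotProduct, dotProduct_smul, smul_mulVec, smul_eq_mul, sub_dotProduct,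
    dotProduct_sub, dotProduct_comm y w] at h3 ⊢
  rw [← mul_nonneg_iff_of_pos_left hγ]
  have e : γ * (γ⁻¹ * (a ⬝ᵥ R *ᵥ a) - 2 * (γ⁻¹ * ((Aᵀ *ᵥ x + Cᵀ *ᵥ u) ⬝ᵥ R *ᵥ x)) -
      2 * (w ⬝ᵥ y) + γ * (u ⬝ᵥ u + w ⬝ᵥ w)) =
      a ⬝ᵥ R *ᵥ a - 2 * ((Aᵀ *ᵥ x + Cᵀ *ᵥ u) ⬝ᵥ R *ᵥ x) - 2 * γ * (w ⬝ᵥ y) +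
        γ ^ 2 * (u ⬝ᵥ u) + γ ^ 2 * (w ⬝ᵥ w) := by
    field_simp
    ring
  rw [e]
  linarith

end DissipationInequality

/-! ### Separation from the negative semidefinite cone. -/

section Separation

open scoped Matrix.Norms.L2Operator in
-- Hahn-Banach needs an interior point of the cone. The open unit ball around -1 lies in it, because
-- v·(M+1)v ≤ ‖M+1‖ |v|².
theorem neg_one_mem_interior_quadraticForm_nonpos (ι : Type*) [Fintype ι] [DecidableEq ι] :
    (-1 : Matrix ι ι ℝ) ∈ interior {M : Matrix ι ι ℝ | ∀ v : ι → ℝ, v ⬝ᵥ M *ᵥ v ≤ 0} := by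
  rw [mem_interior_iff_mem_nhds, Metric.mem_nhds_iff]
  refine ⟨1, one_pos, fun M hM v => ?_⟩
  rw [mem_ball_iff_norm, sub_neg_eq_add] at hM
  have h1 := l2_opNorm_mulVec (M + 1) (WithLp.toLp 2 v)
  have h2 := real_inner_le_norm (WithLp.toLp 2 ((M + 1) *ᵥ v)) (WithLp.toLp 2 v)
  have h3 := real_inner_self_eq_norm_sq (WithLp.toLp 2 v)
  simp only [EuclideanSpace.inner_toLp_toLp, star_trivial, add_mulVec, one_mulVec,
    dotProduct_add] at h1 h2 h3
  have h4 : ‖WithLp.toLp 2 (M *ᵥ v + v)‖ * ‖WithLp.toLp 2 v‖ ≤ ‖WithLp.toLp 2 v‖ ^ 2 := by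
    rw [sq]
    gcongr
    exact h1.trans (mul_le_of_le_one_left (norm_nonneg _) hM.le)
  linarith

open scoped Matrix.Norms.L2Operator MatrixOrder in
/-- A convex set of real matrices none of which has a negative semidefinite quadratic form is
separated from the cone of these matrices by a positive semidefinite matrix `W Wᵀ`. -/
theorem exists_trace_nonneg_of_convex {ι : Type*} [Fintype ι] [DecidableEq ι]
    {t : Set (Matrix ι ι ℝ)} (ht : Convex ℝ t) (hne : t.Nonempty)
    (h : ∀ M ∈ t, ∃ v : ι → ℝ, 0 < v ⬝ᵥ M *ᵥ v) :
    ∃ W : Matrix ι ι ℝ, W ≠ 0 ∧ ∀ M ∈ t, 0 ≤ (Wᵀ * M * W).trace := by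
  set S : Set (Matrix ι ι ℝ) := {M | ∀ v : ι → ℝ, v ⬝ᵥ M *ᵥ v ≤ 0} with hS
  have hconv : Convex ℝ S := by
    intro M hM N hN a b ha hb _ v
    simp only [add_mulVec, smul_mulVec, dotProduct_add, dotProduct_smul, smul_eq_mul]
    have := mul_nonpos_of_nonneg_of_nonpos ha (hM v)
    have := mul_nonpos_of_nonneg_of_nonpos hb (hN v)
    linarith
  have hdisj : Disjoint (interior S) t := by
    rw [Set.disjoint_left]
    intro M hM hMt
    obtain ⟨v, hv⟩ := h M hMt
    exact absurd (interior_subset hM v) (not_le.2 hv)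
  obtain ⟨f, u, hf, hfS, hft⟩ := geometric_hahn_banach_of_nonempty_interior hconv ht hdisj
    ⟨-1, neg_one_mem_interior_quadraticForm_nonpos ι⟩ hne
  have hu : 0 ≤ u := by simpa using hfS 0 (fun v => by simp)
  have hfS0 : ∀ M ∈ S, f M ≤ 0 := by
    intro M hM
    by_contra! hpos
    -- Scaling inside the cone would bring f to u + 1, above its bound u.
    have := hfS (((u + 1) / f M) • M) (fun v => by
      simp only [smul_mulVec, dotProduct_smul, smul_eq_mul]
      exact mul_nonpos_of_nonneg_of_nonpos (by positivity) (hM v))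
    rw [map_smul, smul_eq_mul, div_mul_cancel₀ _ hpos.ne'] at this
    linarith
  set Z : Matrix ι ι ℝ := of fun i j => f (single i j 1) with hZ
  have hfZ : ∀ M, f M = (Zᵀ * M).trace := by
    intro M
    conv_lhs => rw [matrix_eq_sum_single M]
    simp only [map_sum, trace, diag, mul_apply, transpose_apply, hZ, of_apply]
    rw [Finset.sum_comm]
    refine Finset.sum_congr rfl fun i _ => Finset.sum_congr rfl fun j _ => ?_
    have : single j i (M j i) = M j i • single j i (1 : ℝ) := by simp
    rw [this, map_smul, smul_eq_mul, mul_comm]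
  -- Skew matrices have zero quadratic form, so they lie in the cone together with their negatives
  -- and f vanishes on them.
  have hZsymm : Zᵀ = Z := by
    ext i j
    have key : ∀ i j, f (single i j 1) ≤ f (single j i 1) := by
      intro i j
      have := hfS0 (single i j 1 - single j i 1) (fun v => by
        simp [sub_mulVec, single_mulVec, Function.update_apply, dotProduct, mul_comm, mul_sub,
          Finset.sum_sub_distrib])
      rw [map_sub] at this
      linarith
    exact le_antisymm (key j i) (key i j)
  have hZpos : Z.PosSemidef := by
    refine PosSemidef.of_dotProduct_mulVec_nonneg
      (by rw [IsHermitian, conjTranspose_eq_transpose_of_trivial, hZsymm]) fun v => ?_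
    -- Testing f on -vvᵀ gives positivity of Z.
    have h1 := hfS0 (-vecMulVec v v) (fun x => by
      simp only [neg_mulVec, dotProduct_neg, vecMulVec_mulVec, dotProduct_smul,
        Left.neg_nonpos_iff, dotProduct_comm v x]
      simpa using mul_self_nonneg (x ⬝ᵥ v))
    rw [hfZ, hZsymm, mul_neg, trace_neg, mul_vecMulVec, trace_vecMulVec, dotProduct_comm] at h1
    simpa using h1
  obtain ⟨V, hV⟩ : ∃ V : Matrix ι ι ℝ, Z = Vᵀ * V := by
    obtain ⟨V, hV⟩ := CStarAlgebra.nonneg_iff_eq_star_mul_self.mp hZpos.nonneg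
    exact ⟨V, by rw [hV, star_eq_conjTranspose, conjTranspose_eq_transpose_of_trivial]⟩
  refine ⟨Vᵀ, ?_, fun M hM => ?_⟩
  · intro h0
    apply hf
    ext M
    rw [hfZ, hZsymm, hV, h0]
    simp
  · have := hu.trans (hft M hM)
    rwa [hfZ, hZsymm, hV, mul_assoc, trace_mul_comm, ← transpose_transpose V] at this

end Separation

/-! ### Diagonalization of skew relations between signal matrices. -/

section Spectral

open scoped ComplexOrder

theorem Matrix.IsHermitian.exists_unitary_diagonal {ι : Type*} [Fintype ι] [DecidableEq ι]
    {M : Matrix ι ι ℂ} (hM : M.IsHermitian) :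
    ∃ (V : Matrix ι ι ℂ) (d : ι → ℝ), Vᴴ * V = 1 ∧ V * Vᴴ = 1 ∧
      M = V * diagonal (fun i => (d i : ℂ)) * Vᴴ := by
  refine ⟨hM.eigenvectorUnitary, hM.eigenvalues, ?_, ?_, ?_⟩
  · simpa [star_eq_conjTranspose] using
      Unitary.coe_star_mul_self hM.eigenvectorUnitary
  · simpa [star_eq_conjTranspose] using
      Unitary.coe_mul_star_self hM.eigenvectorUnitary
  · have := hM.spectral_theorem
    rw [Unitary.conjStarAlgAut_apply] at this
    exact this

theorem Matrix.IsHermitian.exists_pseudoinverse {ι : Type*} [Fintype ι] [DecidableEq ι]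
    {M : Matrix ι ι ℂ} (hM : M.IsHermitian) :
    ∃ X : Matrix ι ι ℂ, X.IsHermitian ∧ M * X * M = M := by
  obtain ⟨V, d, h1, -, rfl⟩ := hM.exists_unitary_diagonal
  have key : ∀ a b c : Matrix ι ι ℂ,
      V * a * Vᴴ * (V * b * Vᴴ) * (V * c * Vᴴ) = V * (a * b * c) * Vᴴ := by
    intro a b c
    calc _ = V * a * (Vᴴ * V) * b * (Vᴴ * V) * c * Vᴴ := by simp only [Matrix.mul_assoc]
      _ = _ := by rw [h1]; simp only [Matrix.mul_one, Matrix.mul_assoc]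
  -- The convention 0⁻¹ = 0 makes this the pseudoinverse: d d⁻¹ d = d also for zero eigenvalues.
  refine ⟨V * diagonal (fun i => ((d i)⁻¹ : ℂ)) * Vᴴ, ?_, ?_⟩
  · rw [IsHermitian, conjTranspose_mul, conjTranspose_mul, conjTranspose_conjTranspose,
      diagonal_conjTranspose, Matrix.mul_assoc]
    congr 4
    ext i
    simp
  · rw [key, diagonal_mul_diagonal, diagonal_mul_diagonal]
    congr 4
    ext i
    exact mul_inv_mul_cancel _

/-- If `G Fᴴ` is skew-Hermitian then, on the orthogonal complement of the kernel of `F`, the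
relation `G v = i ω F v` can be diagonalized in an orthonormal basis. -/
theorem exists_projection_diagonalization {n ι : Type*} [Fintype n] [DecidableEq n] [Fintype ι]
    [DecidableEq ι] {F G : Matrix n ι ℂ} (h : G * Fᴴ + F * Gᴴ = 0) :
    ∃ (P V : Matrix ι ι ℂ) (ω : ι → ℝ), Pᴴ = P ∧ P * P = P ∧ V * Vᴴ = 1 ∧ F * P = F ∧
      G * P * V = F * P * V * diagonal (fun i => (ω i : ℂ) * Complex.I) := by
  obtain ⟨X, hX, h1⟩ := (isHermitian_mul_conjTranspose_self F).exists_pseudoinverse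
  have hskew : G * Fᴴ = -(F * Gᴴ) := eq_neg_of_add_eq_zero_left h
  -- P is the orthogonal projection onto the complement of the kernel of F.
  set P := Fᴴ * X * F with hP
  have hFP : F * P = F := by
    have h3 : (F * P - F) * Fᴴ = 0 := by
      rw [Matrix.sub_mul, hP]
      simp only [← Matrix.mul_assoc] at h1 ⊢
      simp only [Matrix.mul_assoc] at h1 ⊢
      rw [h1, sub_self]
    have h4 : (F * P - F) * (F * P - F)ᴴ = 0 := by
      have : (F * P - F)ᴴ = Fᴴ * (X * F * Fᴴ - 1) := by
        rw [hP]
        simp only [conjTranspose_sub, conjTranspose_mul, conjTranspose_conjTranspose, hX.eq,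
          Matrix.mul_sub, Matrix.mul_one, Matrix.mul_assoc]
      rw [this, ← Matrix.mul_assoc, h3, Matrix.zero_mul]
    exact sub_eq_zero.1 (self_mul_conjTranspose_eq_zero.1 h4)
  have hPH : Pᴴ = P := by
    rw [hP]
    simp only [conjTranspose_mul, conjTranspose_conjTranspose, hX.eq, Matrix.mul_assoc]
  -- S solves F S = G P and is skew-Hermitian, so I • S is unitarily diagonalizable with real
  -- eigenvalues.
  set S := Fᴴ * X * G * P with hS
  have hGP : G * P = -(F * Gᴴ * X * F) := by
    rw [hP, ← Matrix.mul_assoc, ← Matrix.mul_assoc, hskew, Matrix.neg_mul, Matrix.neg_mul]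
  have hFS : F * S = G * P := by
    calc F * S = F * Fᴴ * X * (G * P) := by rw [hS]; simp only [Matrix.mul_assoc]
      _ = -(F * (Fᴴ * X * F) * Gᴴ * X * F) := by
        rw [hGP]; simp only [Matrix.mul_assoc, Matrix.mul_neg]
      _ = G * P := by rw [← hP, hFP, hGP]
  have hSskew : Sᴴ = -S := by
    have e1 : S = Fᴴ * X * (G * Fᴴ) * X * F := by
      rw [hS, hP]; simp only [Matrix.mul_assoc]
    have e2 : Sᴴ = Fᴴ * X * (F * Gᴴ) * X * F := by
      rw [e1]
      simp only [conjTranspose_mul, conjTranspose_conjTranspose, hX.eq, Matrix.mul_assoc]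
    rw [e2, e1, hskew]
    simp only [Matrix.mul_neg, Matrix.neg_mul, neg_neg]
  have hH : (Complex.I • S).IsHermitian := by
    rw [IsHermitian, conjTranspose_smul, hSskew]
    simp
  obtain ⟨V, d, hV1, hV2, hV⟩ := hH.exists_unitary_diagonal
  have hSV : S * V = V * diagonal (fun i => ((-d i : ℝ) : ℂ) * Complex.I) := by
    have e1 : S = (-Complex.I) • (Complex.I • S) := by
      rw [smul_smul]; simp
    rw [e1, hV, Matrix.smul_mul, Matrix.mul_assoc _ Vᴴ, hV1, Matrix.mul_one, ← Matrix.mul_smul, ← diagonal_smul]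
    congr 2
    ext i
    simp [mul_comm]
  refine ⟨P, V, fun i => -d i, hPH, ?_, hV2, hFP, ?_⟩
  · conv_lhs => rw [hP, Matrix.mul_assoc, hFP]
  · rw [hFP, Matrix.mul_assoc F, ← hSV, ← Matrix.mul_assoc F, hFS]

/-- Pythagoras for the Frobenius norm: P and 1 - P are complementary orthogonal projections, and the
unitary V preserves the norm. -/
theorem trace_conjTranspose_mul_self_eq_add {κ ι : Type*} [Fintype κ] [Fintype ι] [DecidableEq ι]
    (Y : Matrix κ ι ℂ) {P V : Matrix ι ι ℂ} (hP : Pᴴ = P) (hPP : P * P = P) (hV : V * Vᴴ = 1) :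
    (Yᴴ * Y).trace =
      ((Y * P * V)ᴴ * (Y * P * V)).trace + ((Y * (1 - P))ᴴ * (Y * (1 - P))).trace := by
  have h1 : ((Y * P * V)ᴴ * (Y * P * V)).trace = (Y * P * Yᴴ).trace := by
    rw [trace_mul_comm]
    congr 1
    calc _ = Y * P * (V * Vᴴ) * Pᴴ * Yᴴ := by
          simp only [conjTranspose_mul, Matrix.mul_assoc]
      _ = Y * (P * P) * Yᴴ := by rw [hV, hP]; simp only [Matrix.mul_one, Matrix.mul_assoc]
      _ = _ := by rw [hPP]
  have h2 : ((Y * (1 - P))ᴴ * (Y * (1 - P))).trace = (Y * (1 - P) * Yᴴ).trace := by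
    rw [trace_mul_comm]
    congr 1
    have : (1 - P) * (1 - P) = 1 - P := by
      rw [Matrix.sub_mul, Matrix.one_mul, Matrix.mul_sub, Matrix.mul_one, hPP, sub_self, sub_zero]
    rw [conjTranspose_mul, conjTranspose_sub, conjTranspose_one, hP, ← Matrix.mul_assoc,
      Matrix.mul_assoc Y, this]
  rw [h1, h2, ← trace_add, ← Matrix.add_mul, ← Matrix.mul_add, add_sub_cancel, Matrix.mul_one, trace_mul_comm]

end Spectral

/-! ### Hurwitz matrices and Lyapunov's theorem. -/

section Hurwitz

open Filter Topology

variable {n : ℕ} {A : Matrix (Fin n) (Fin n) ℝ}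

theorem hasEigenvalue_toLin'_iff_not_isUnit {ι : Type*} [Fintype ι] [DecidableEq ι]
    (M : Matrix ι ι ℂ) (μ : ℂ) :
    Module.End.HasEigenvalue (toLin' M) μ ↔ ¬ IsUnit (μ • (1 : Matrix ι ι ℂ) - M) := by
  rw [Module.End.hasEigenvalue_iff_mem_spectrum, Matrix.spectrum_toLin', spectrum.mem_iff,
    Algebra.algebraMap_eq_smul_one]

theorem IsHurwitz.isUnit (hA : IsHurwitz A) {s : ℂ} (hs : 0 ≤ s.re) :
    IsUnit (s • (1 : Matrix (Fin n) (Fin n) ℂ) - A.map (algebraMap ℝ ℂ)) := by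
  by_contra h
  exact absurd (hA s ((hasEigenvalue_toLin'_iff_not_isUnit _ _).2 h)) (not_lt.2 hs)

theorem isHurwitz_of_conjTranspose_eigenvector
    (h : ∀ (s : ℂ) (x : Fin n → ℂ), x ≠ 0 →
      (A.map (algebraMap ℝ ℂ))ᴴ *ᵥ x = s • x → s.re < 0) : IsHurwitz A := by
  intro μ hμ
  rw [hasEigenvalue_toLin'_iff_not_isUnit, isUnit_iff_isUnit_det, isUnit_iff_ne_zero, not_not]
    at hμ
  have hdet : ((μ • (1 : Matrix (Fin n) (Fin n) ℂ) - A.map (algebraMap ℝ ℂ))ᴴ).det = 0 := by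
    rw [det_conjTranspose, hμ, star_zero]
  obtain ⟨x, hx, hx0⟩ := exists_mulVec_eq_zero_iff.2 hdet
  rw [conjTranspose_sub, conjTranspose_smul, conjTranspose_one, sub_mulVec, smul_mulVec,
    one_mulVec, sub_eq_zero] at hx0
  simpa using h (star μ) x hx hx0.symm

/-- By Gelfand's formula, ‖a ^ k‖ is eventually below r ^ k for some r < 1. -/
theorem tendsto_pow_zero_of_spectralRadius_lt_one {𝔸 : Type*} [NormedRing 𝔸] [NormedAlgebra ℂ 𝔸]
    [CompleteSpace 𝔸] {a : 𝔸} (ha : spectralRadius ℂ a < 1) :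
    Tendsto (fun k => a ^ k) atTop (𝓝 0) := by
  obtain ⟨r, hr, hr1⟩ := ENNReal.lt_iff_exists_nnreal_btwn.1 ha
  have hg := spectrum.pow_nnnorm_pow_one_div_tendsto_nhds_spectralRadius a
  rw [tendsto_zero_iff_norm_tendsto_zero]
  refine squeeze_zero' (.of_forall fun _ => norm_nonneg _) ?_
    (tendsto_pow_atTop_nhds_zero_of_lt_one r.coe_nonneg (by exact_mod_cast hr1))
  filter_upwards [hg.eventually_lt_const hr, eventually_gt_atTop 0] with k hk hk0
  have h1 := ENNReal.rpow_le_rpow hk.le (Nat.cast_nonneg k : (0 : ℝ) ≤ k)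
  rw [← ENNReal.rpow_mul, one_div, inv_mul_cancel₀ (by positivity), ENNReal.rpow_one,
    ENNReal.rpow_natCast] at h1
  exact_mod_cast h1

-- The Cayley transform maps the open left half-plane into the unit disc, so T has spectral radius
-- below 1. The entrywise form is independent of the norm chosen on matrices.
open scoped Matrix.Norms.L2Operator in
theorem IsHurwitz.tendsto_cayley_pow_apply (hA : IsHurwitz A) {T : Matrix (Fin n) (Fin n) ℝ}
    (hT : (1 - A) * T = 1 + A) (i j : Fin n) : Tendsto (fun k => (T ^ k) i j) atTop (𝓝 0) := by
  set Ac := A.map (algebraMap ℝ ℂ) with hAc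
  set Tc := T.map (algebraMap ℝ ℂ) with hTc
  have hTc' : (1 - Ac) * Tc = 1 + Ac := by
    have := congrArg (algebraMap ℝ ℂ).mapMatrix hT
    rwa [map_mul, map_sub, map_add, map_one] at this
  have hspec : ∀ z ∈ spectrum ℂ Tc, ‖z‖₊ < 1 := by
    intro z hz
    by_contra! hz1
    have hz1' : 1 ≤ z.re * z.re + z.im * z.im := by
      rw [← Complex.normSq_apply, Complex.normSq_eq_norm_sq]
      exact one_le_pow₀ (by exact_mod_cast hz1)
    apply hz
    rw [spectrum.mem_resolventSet_iff, Algebra.algebraMap_eq_smul_one]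
    have e : (1 - Ac) * (z • (1 : Matrix (Fin n) (Fin n) ℂ) - Tc) = (z - 1) • 1 - (z + 1) • Ac := by
      rw [mul_sub, hTc', mul_smul_comm, mul_one]
      module
    have hu : IsUnit ((z - 1) • (1 : Matrix (Fin n) (Fin n) ℂ) - (z + 1) • Ac) := by
      by_cases hz0 : z + 1 = 0
      · rw [hz0, zero_smul, sub_zero]
        have : z - 1 ≠ 0 := by
          intro h
          have : (2 : ℂ) = (z + 1) - (z - 1) := by ring
          rw [h, hz0] at this
          norm_num at this
        exact isUnit_one.smul (Units.mk0 _ this)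
      -- The numerator of this real part is |z|² - 1.
      · have hre : 0 ≤ ((z - 1) / (z + 1)).re := by
          rw [Complex.div_re, ← add_div]
          apply div_nonneg _ (Complex.normSq_nonneg _)
          simp
          nlinarith
        have := (hA.isUnit hre).smul (Units.mk0 _ hz0)
        rwa [Units.smul_mk0, smul_sub, smul_smul, mul_div_cancel₀ _ hz0] at this
    rw [← e, isUnit_iff_isUnit_det, det_mul] at hu
    exact (isUnit_iff_isUnit_det _).2 (isUnit_of_mul_isUnit_right hu)
  have hrad : spectralRadius ℂ Tc < 1 := by
    rcases isEmpty_or_nonempty (Fin n) with hn | hn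
    · simp [spectralRadius, spectrum.of_subsingleton]
    · exact_mod_cast spectrum.spectralRadius_lt_of_forall_lt Tc hspec
  have hlim := tendsto_pow_zero_of_spectralRadius_lt_one hrad
  have h1 : Tendsto (fun k => ((Tc ^ k) i j).re) atTop (𝓝 0) := by
    have h2 : Continuous fun M : Matrix (Fin n) (Fin n) ℂ => (M i j).re := by fun_prop
    have h3 := (h2.tendsto 0).comp hlim
    rwa [Matrix.zero_apply, Complex.zero_re] at h3
  refine h1.congr fun k => ?_
  have : Tc ^ k = (T ^ k).map (algebraMap ℝ ℂ) := by
    rw [hTc]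
    exact (map_pow (algebraMap ℝ ℂ).mapMatrix T k).symm
  rw [this]
  simp

theorem IsHurwitz.isUnit_one_sub (hA : IsHurwitz A) : IsUnit (1 - A) := by
  have h := hA.isUnit (s := 1) (by simp)
  have e : (1 : ℂ) • (1 : Matrix (Fin n) (Fin n) ℂ) - A.map (algebraMap ℝ ℂ) =
      (algebraMap ℝ ℂ).mapMatrix (1 - A) := by
    rw [one_smul, map_sub, map_one]
    rfl
  rw [e, isUnit_iff_isUnit_det, ← RingHom.map_det, isUnit_iff_ne_zero, ne_eq,
    map_eq_zero] at h
  exact (isUnit_iff_isUnit_det _).2 (isUnit_iff_ne_zero.2 h)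

/-- Lyapunov: for a Hurwitz matrix `A`, if `A R + R Aᵀ` is negative semidefinite then `R` is
positive semidefinite. -/
theorem IsHurwitz.posSemidef_of_lyapunov (hA : IsHurwitz A) {R : Matrix (Fin n) (Fin n) ℝ}
    (hR : R.IsSymm) (h : ∀ x : Fin n → ℝ, (Aᵀ *ᵥ x) ⬝ᵥ (R *ᵥ x) ≤ 0) : R.PosSemidef := by
  refine PosSemidef.of_dotProduct_mulVec_nonneg
    (by rw [IsHermitian, conjTranspose_eq_transpose_of_trivial]; exact hR) fun x => ?_
  rw [star_trivial]
  have hunit := hA.isUnit_one_sub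
  rw [isUnit_iff_isUnit_det] at hunit
  set T := (1 - A)⁻¹ * (1 + A) with hTdef
  have hT : (1 - A) * T = 1 + A := by
    rw [hTdef, ← mul_assoc, mul_nonsing_inv _ hunit, one_mul]
  -- With z = (1 - A)ᵀy, the two sides differ by 4 (Aᵀy)·Ry ≤ 0. Iterating, with T ^ k → 0, bounds
  -- x·Rx below by 0.
  have hstep : ∀ z : Fin n → ℝ, (Tᵀ *ᵥ z) ⬝ᵥ R *ᵥ (Tᵀ *ᵥ z) ≤ z ⬝ᵥ R *ᵥ z := by
    intro z
    obtain ⟨y, rfl⟩ : ∃ y, z = (1 - A)ᵀ *ᵥ y := by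
      refine ⟨((1 - A)ᵀ)⁻¹ *ᵥ z, ?_⟩
      rw [mulVec_mulVec, mul_nonsing_inv _ (by rwa [det_transpose]), one_mulVec]
    have h1 : Tᵀ *ᵥ ((1 - A)ᵀ *ᵥ y) = y + Aᵀ *ᵥ y := by
      rw [mulVec_mulVec, ← transpose_mul, hT, transpose_add, transpose_one, add_mulVec, one_mulVec]
    have h2 : (1 - A)ᵀ *ᵥ y = y - Aᵀ *ᵥ y := by
      rw [transpose_sub, transpose_one, sub_mulVec, one_mulVec]
    have h3 : y ⬝ᵥ R *ᵥ (Aᵀ *ᵥ y) = (Aᵀ *ᵥ y) ⬝ᵥ R *ᵥ y := by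
      rw [dotProduct_mulVec, ← mulVec_transpose, hR.eq, dotProduct_comm]
    rw [h1, h2]
    simp only [mulVec_add, mulVec_sub, add_dotProduct, sub_dotProduct, dotProduct_add,
      dotProduct_sub, h3]
    linarith [h y]
  have hbound : ∀ k : ℕ, x ⬝ᵥ (T ^ k * R * (T ^ k)ᵀ) *ᵥ x ≤ x ⬝ᵥ R *ᵥ x := by
    have e : ∀ k : ℕ, x ⬝ᵥ (T ^ k * R * (T ^ k)ᵀ) *ᵥ x =
        ((T ^ k)ᵀ *ᵥ x) ⬝ᵥ R *ᵥ ((T ^ k)ᵀ *ᵥ x) := fun k => by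
      rw [← mulVec_mulVec, ← mulVec_mulVec, dotProduct_mulVec, ← mulVec_transpose]
    intro k
    induction k with
    | zero => simp
    | succ k ih =>
      refine le_trans ?_ ih
      rw [e, e, pow_succ, transpose_mul, ← mulVec_mulVec]
      exact hstep _
  have hlim : Tendsto (fun k => T ^ k) atTop (𝓝 0) :=
    tendsto_pi_nhds.2 fun i => tendsto_pi_nhds.2 fun j => hA.tendsto_cayley_pow_apply hT i j
  have hcont : Continuous fun M : Matrix (Fin n) (Fin n) ℝ => x ⬝ᵥ (M * R * Mᵀ) *ᵥ x := by
    fun_prop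
  have h0 := (hcont.tendsto 0).comp hlim
  simp only [zero_mul, zero_mulVec, dotProduct_zero] at h0
  exact le_of_tendsto' h0 hbound

end Hurwitz

/-! ### Transfer matrices: bounds from dissipation and boundary values. -/

section TransferMatrix

open Filter Topology

theorem re_star_dotProduct {ι : Type*} [Fintype ι] (a b : ι → ℂ) :
    (star a ⬝ᵥ b).re = (fun i => (a i).re) ⬝ᵥ (fun i => (b i).re)
      + (fun i => (a i).im) ⬝ᵥ (fun i => (b i).im) := by
  simp [dotProduct, Finset.sum_add_distrib]

theorem re_map_algebraMap_mulVec {κ ι : Type*} [Fintype ι] (M : Matrix κ ι ℝ) (z : ι → ℂ) :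
    (fun i => ((M.map (algebraMap ℝ ℂ) *ᵥ z) i).re) = M *ᵥ fun i => (z i).re := by
  ext i
  simp [mulVec, dotProduct]

theorem im_map_algebraMap_mulVec {κ ι : Type*} [Fintype ι] (M : Matrix κ ι ℝ) (z : ι → ℂ) :
    (fun i => ((M.map (algebraMap ℝ ℂ) *ᵥ z) i).im) = M *ᵥ fun i => (z i).im := by
  ext i
  simp [mulVec, dotProduct]

theorem conjTranspose_map_algebraMap {κ ι : Type*} (M : Matrix κ ι ℝ) :
    (M.map (algebraMap ℝ ℂ))ᴴ = Mᵀ.map (algebraMap ℝ ℂ) := by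
  ext i j
  simp

theorem re_star_dotProduct_self {ι : Type*} [Fintype ι] (z : ι → ℂ) :
    (star z ⬝ᵥ z).re = ‖WithLp.toLp 2 z‖ ^ 2 := by
  rw [← inner_self_eq_norm_sq (𝕜 := ℂ), EuclideanSpace.inner_toLp_toLp, dotProduct_comm]
  rfl

theorem re_star_dotProduct_map_mulVec_nonneg {ι : Type*} [Fintype ι] {R : Matrix ι ι ℝ}
    (hR : R.PosSemidef) (x : ι → ℂ) : 0 ≤ (star x ⬝ᵥ R.map (algebraMap ℝ ℂ) *ᵥ x).re := by
  rw [re_star_dotProduct, re_map_algebraMap_mulVec, im_map_algebraMap_mulVec]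
  have h := hR.dotProduct_mulVec_nonneg
  simp only [star_trivial] at h
  exact add_nonneg (h _) (h _)

theorem im_star_dotProduct_map_mulVec {ι : Type*} [Fintype ι] {R : Matrix ι ι ℝ}
    (hR : R.IsHermitian) (x : ι → ℂ) : (star x ⬝ᵥ R.map (algebraMap ℝ ℂ) *ᵥ x).im = 0 :=
  (hR.map (algebraMap ℝ ℂ) fun a => (Complex.conj_ofReal a).symm).im_star_dotProduct_mulVec_self x

open scoped Matrix.Norms.L2Operator in
theorem l2_opNorm_le_of_forall {κ ι : Type*} [Fintype κ] [Fintype ι] [DecidableEq ι]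
    {M : Matrix κ ι ℂ} {c : ℝ} (hc : 0 ≤ c)
    (h : ∀ u, (star (M *ᵥ u) ⬝ᵥ (M *ᵥ u)).re ≤ c ^ 2 * (star u ⬝ᵥ u).re) : ‖M‖ ≤ c := by
  rw [l2_opNorm_def]
  refine ContinuousLinearMap.opNorm_le_bound _ hc fun v => ?_
  have := h v.ofLp
  rw [re_star_dotProduct_self, re_star_dotProduct_self, ← mul_pow] at this
  exact (pow_le_pow_iff_left₀ (norm_nonneg _) (by positivity) two_ne_zero).1 this

open scoped Matrix.Norms.L2Operator in
theorem re_star_mulVec_dotProduct_le {κ ι : Type*} [Fintype κ] [Fintype ι] [DecidableEq ι]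
    {M : Matrix κ ι ℂ} {c : ℝ} (h : ‖M‖ ≤ c) (u : ι → ℂ) :
    (star (M *ᵥ u) ⬝ᵥ (M *ᵥ u)).re ≤ c ^ 2 * (star u ⬝ᵥ u).re := by
  rw [re_star_dotProduct_self, re_star_dotProduct_self, ← mul_pow]
  gcongr
  exact (l2_opNorm_mulVec M (WithLp.toLp 2 u)).trans (by gcongr)

variable {n m p : ℕ} {A : Matrix (Fin n) (Fin n) ℝ} {B : Matrix (Fin n) (Fin m) ℝ}
  {C : Matrix (Fin p) (Fin n) ℝ} {D : Matrix (Fin p) (Fin m) ℝ} {R : Matrix (Fin n) (Fin n) ℝ}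
  {γ : ℝ}

/-- The data are real, so the inequalities for the real and imaginary parts add up. -/
theorem DissipationInequality.complex (h : DissipationInequality A B C D R γ) (x : Fin n → ℂ)
    (u : Fin p → ℂ) :
    2 * (star ((A.map (algebraMap ℝ ℂ))ᴴ *ᵥ x + (C.map (algebraMap ℝ ℂ))ᴴ *ᵥ u) ⬝ᵥ
        (R.map (algebraMap ℝ ℂ) *ᵥ x)).re
      + (star ((B.map (algebraMap ℝ ℂ))ᴴ *ᵥ x + (D.map (algebraMap ℝ ℂ))ᴴ *ᵥ u) ⬝ᵥ
        ((B.map (algebraMap ℝ ℂ))ᴴ *ᵥ x + (D.map (algebraMap ℝ ℂ))ᴴ *ᵥ u)).re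
      ≤ γ ^ 2 * (star u ⬝ᵥ u).re := by
  have h1 := h (fun i => (x i).re) (fun i => (u i).re)
  have h2 := h (fun i => (x i).im) (fun i => (u i).im)
  have hre : ∀ {k : ℕ} (a b : Fin k → ℂ),
      (fun i => ((a + b) i).re) = (fun i => (a i).re) + fun i => (b i).re := fun _ _ => rfl
  have him : ∀ {k : ℕ} (a b : Fin k → ℂ),
      (fun i => ((a + b) i).im) = (fun i => (a i).im) + fun i => (b i).im := fun _ _ => rfl
  simp only [conjTranspose_map_algebraMap, re_star_dotProduct, hre, him,
    re_map_algebraMap_mulVec, im_map_algebraMap_mulVec]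
  linarith

/-- At an eigenvector of Aᴴ the inequality with u = 0 is 2 Re(s) x*Rx + |Bᴴx|² ≤ 0, and Bᴴx ≠ 0
because B Bᵀ is invertible. -/
theorem DissipationInequality.isHurwitz (h : DissipationInequality A B C D R γ)
    (hR : R.PosSemidef) (hB : (B * Bᵀ).PosDef) : IsHurwitz A := by
  refine isHurwitz_of_conjTranspose_eigenvector fun s x hx hs => ?_
  have h1 := h.complex x 0
  have h2 := re_star_dotProduct_map_mulVec_nonneg hR x
  simp only [mulVec_zero, add_zero, dotProduct_zero, Complex.zero_re, mul_zero, hs, star_smul,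
    smul_dotProduct, re_star_dotProduct_self ((B.map (algebraMap ℝ ℂ))ᴴ *ᵥ x)] at h1
  have h3 := im_star_dotProduct_map_mulVec hR.1 x
  have h4 : 0 < ‖WithLp.toLp 2 ((B.map (algebraMap ℝ ℂ))ᴴ *ᵥ x)‖ := by
    rw [norm_pos_iff, ne_eq, WithLp.toLp_eq_zero]
    intro h0
    have h5 : (B * Bᵀ).map (algebraMap ℝ ℂ) *ᵥ x = 0 := by
      rw [Matrix.map_mul, ← conjTranspose_map_algebraMap, ← mulVec_mulVec, h0, mulVec_zero]
    have h6 : IsUnit ((B * Bᵀ).map (algebraMap ℝ ℂ)) := hB.isUnit.map (algebraMap ℝ ℂ).mapMatrix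
    exact hx (mulVec_injective_iff_isUnit.2 h6 (h5.trans (mulVec_zero _).symm))
  rw [smul_eq_mul, Complex.mul_re, h3, mul_zero, sub_zero, Complex.star_def, Complex.conj_re] at h1
  by_contra! hs0
  have := mul_nonneg hs0 h2
  have := pow_pos h4 2
  linarith

/-- The adjoint system: x is the state driven by u at frequency `star s`, and G(s)ᴴu is its output.
-/
theorem conjTranspose_transferMatrix_mulVec {s : ℂ}
    (hs : IsUnit (s • (1 : Matrix (Fin n) (Fin n) ℂ) - A.map (algebraMap ℝ ℂ)))
    {x : Fin n → ℂ} {u : Fin p → ℂ}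
    (hx : (A.map (algebraMap ℝ ℂ))ᴴ *ᵥ x + (C.map (algebraMap ℝ ℂ))ᴴ *ᵥ u = star s • x) :
    (transferMatrix A B C D s)ᴴ *ᵥ u =
      (B.map (algebraMap ℝ ℂ))ᴴ *ᵥ x + (D.map (algebraMap ℝ ℂ))ᴴ *ᵥ u := by
  have h1 : (C.map (algebraMap ℝ ℂ))ᴴ *ᵥ u =
      (s • (1 : Matrix (Fin n) (Fin n) ℂ) - A.map (algebraMap ℝ ℂ))ᴴ *ᵥ x := by
    rw [conjTranspose_sub, conjTranspose_smul, conjTranspose_one, sub_mulVec, smul_mulVec,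
      one_mulVec, ← hx, add_sub_cancel_left]
  have h2 : ((s • (1 : Matrix (Fin n) (Fin n) ℂ) - A.map (algebraMap ℝ ℂ))⁻¹)ᴴ *ᵥ
      ((s • (1 : Matrix (Fin n) (Fin n) ℂ) - A.map (algebraMap ℝ ℂ))ᴴ *ᵥ x) = x := by
    rw [mulVec_mulVec, ← conjTranspose_mul,
      mul_nonsing_inv _ ((isUnit_iff_isUnit_det _).1 hs), conjTranspose_one, one_mulVec]
  rw [transferMatrix, conjTranspose_add, conjTranspose_mul, conjTranspose_mul, add_mulVec,
    ← mulVec_mulVec, ← mulVec_mulVec, h1, h2]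

theorem exists_state {s : ℂ}
    (hs : IsUnit (s • (1 : Matrix (Fin n) (Fin n) ℂ) - A.map (algebraMap ℝ ℂ))) (u : Fin p → ℂ) :
    ∃ x : Fin n → ℂ,
      (A.map (algebraMap ℝ ℂ))ᴴ *ᵥ x + (C.map (algebraMap ℝ ℂ))ᴴ *ᵥ u = star s • x := by
  have hs' : IsUnit (s • (1 : Matrix (Fin n) (Fin n) ℂ) - A.map (algebraMap ℝ ℂ))ᴴ := by
    rw [isUnit_iff_isUnit_det] at hs ⊢
    rw [det_conjTranspose]
    exact hs.star
  obtain ⟨x, hx⟩ := mulVec_surjective_iff_isUnit.2 hs' ((C.map (algebraMap ℝ ℂ))ᴴ *ᵥ u)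
  refine ⟨x, ?_⟩
  rw [← hx, conjTranspose_sub, conjTranspose_smul, conjTranspose_one, sub_mulVec, smul_mulVec,
      one_mulVec, add_sub_cancel]

open scoped Matrix.Norms.L2Operator in
theorem DissipationInequality.norm_transferMatrix_le (h : DissipationInequality A B C D R γ)
    (hγ : 0 ≤ γ) (hR : R.PosSemidef) (hA : IsHurwitz A) {s : ℂ} (hs : 0 < s.re) :
    ‖transferMatrix A B C D s‖ ≤ γ := by
  rw [← l2_opNorm_conjTranspose]
  refine l2_opNorm_le_of_forall hγ fun u => ?_
  obtain ⟨x, hx⟩ := exists_state (C := C) (hA.isUnit hs.le) u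
  have h1 := h.complex x u
  rw [conjTranspose_transferMatrix_mulVec (hA.isUnit hs.le) hx]
  have h2 := re_star_dotProduct_map_mulVec_nonneg hR x
  have h3 := im_star_dotProduct_map_mulVec hR.1 x
  rw [hx, star_smul, star_star, smul_dotProduct, smul_eq_mul, Complex.mul_re, h3, mul_zero,
    sub_zero] at h1
  -- The storage term 2 Re(s) x*Rx is nonnegative and can be dropped.
  have := mul_nonneg hs.le h2
  linarith

open scoped Matrix.Norms.L2Operator in
theorem continuousAt_transferMatrix {s : ℂ}
    (hs : IsUnit (s • (1 : Matrix (Fin n) (Fin n) ℂ) - A.map (algebraMap ℝ ℂ))) :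
    ContinuousAt (transferMatrix A B C D) s := by
  have h1 : ContinuousAt (fun s : ℂ =>
      (s • (1 : Matrix (Fin n) (Fin n) ℂ) - A.map (algebraMap ℝ ℂ))⁻¹) s := by
    simp only [nonsing_inv_eq_ringInverse]
    obtain ⟨v, hv⟩ := hs
    refine ContinuousAt.comp (g := Ring.inverse) ?_ (by fun_prop)
    rw [← hv]
    exact NormedRing.inverse_continuousAt v
  have h2 : Continuous fun M : Matrix (Fin n) (Fin n) ℂ =>
      C.map (algebraMap ℝ ℂ) * M * B.map (algebraMap ℝ ℂ) + D.map (algebraMap ℝ ℂ) := by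
    fun_prop
  exact h2.continuousAt.comp h1

open scoped Matrix.Norms.L2Operator in
theorem norm_transferMatrix_le_of_re_eq_zero (hA : IsHurwitz A)
    (h : ∀ s : ℂ, 0 < s.re → ‖transferMatrix A B C D s‖ ≤ γ) {s : ℂ} (hs : s.re = 0) :
    ‖transferMatrix A B C D s‖ ≤ γ := by
  have h1 : Tendsto (fun t : ℝ => s + t) (𝓝[>] 0) (𝓝 s) := by
    have : Continuous fun t : ℝ => s + t := by fun_prop
    simpa using (this.tendsto 0).mono_left nhdsWithin_le_nhds
  have h2 := ((continuousAt_transferMatrix (B := B) (C := C) (D := D)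
    (hA.isUnit hs.ge)).tendsto.comp h1).norm
  refine le_of_tendsto h2 ?_
  filter_upwards [self_mem_nhdsWithin] with t ht
  exact h _ (by simpa [hs] using ht)

-- D is the value of the transfer matrix at infinity, reached along s = 1/t as t → 0⁺ through (s -
-- A)⁻¹ = t (1 - tA)⁻¹.
open scoped Matrix.Norms.L2Operator in
theorem norm_feedthrough_le (hA : IsHurwitz A)
    (h : ∀ s : ℂ, 0 < s.re → ‖transferMatrix A B C D s‖ ≤ γ) :
    ‖D.map (algebraMap ℝ ℂ)‖ ≤ γ := by
  set Ac := A.map (algebraMap ℝ ℂ) with hAc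
  have h1 : ContinuousAt (fun t : ℝ =>
      (1 - (t : ℂ) • Ac)⁻¹) 0 := by
    simp only [nonsing_inv_eq_ringInverse]
    refine ContinuousAt.comp (g := Ring.inverse) ?_ (by fun_prop)
    simpa using NormedRing.inverse_continuousAt (1 : (Matrix (Fin n) (Fin n) ℂ)ˣ)
  have h2 : ContinuousAt (fun t : ℝ =>
      C.map (algebraMap ℝ ℂ) * ((t : ℂ) • (1 - (t : ℂ) • Ac)⁻¹) * B.map (algebraMap ℝ ℂ)
        + D.map (algebraMap ℝ ℂ)) 0 := by
    have h3 : Continuous fun M : Matrix (Fin n) (Fin n) ℂ =>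
        C.map (algebraMap ℝ ℂ) * M * B.map (algebraMap ℝ ℂ) + D.map (algebraMap ℝ ℂ) := by
      fun_prop
    have h4 : ContinuousAt (fun t : ℝ => (t : ℂ)) 0 := Complex.continuous_ofReal.continuousAt
    exact h3.continuousAt.comp (h4.smul h1)
  have h5 := (h2.tendsto.mono_left (nhdsWithin_le_nhds (s := Set.Ioi 0))).norm
  simp only [Complex.ofReal_zero, zero_smul, Matrix.mul_zero, Matrix.zero_mul, zero_add] at h5
  refine le_of_tendsto h5 ?_
  filter_upwards [self_mem_nhdsWithin] with t ht
  have ht0 : (0 : ℝ) < t := ht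
  have htc : (t : ℂ) ≠ 0 := by exact_mod_cast ht0.ne'
  have hre : 0 < ((t : ℂ)⁻¹).re := by
    rw [← Complex.ofReal_inv, Complex.ofReal_re]
    positivity
  have hu := (isUnit_iff_isUnit_det _).1 (hA.isUnit hre.le)
  have hinv : (t : ℂ) • (1 - (t : ℂ) • Ac)⁻¹ =
      ((t : ℂ)⁻¹ • (1 : Matrix (Fin n) (Fin n) ℂ) - Ac)⁻¹ := by
    have e : 1 - (t : ℂ) • Ac = (t : ℂ) • ((t : ℂ)⁻¹ • (1 : Matrix (Fin n) (Fin n) ℂ) - Ac) := by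
      rw [smul_sub, smul_smul, mul_inv_cancel₀ htc, one_smul]
    rw [e]
    have := inv_smul' _ (Units.mk0 _ htc) hu
    rw [Units.smul_mk0] at this
    rw [this, Units.smul_def, smul_smul, Units.val_inv_eq_inv_val, Units.val_mk0,
      mul_inv_cancel₀ htc, one_smul]
  rw [hinv]
  exact h _ hre

end TransferMatrix

/-! ### The strict bounded real lemma by duality. -/

section BoundedReal

theorem re_trace_conjTranspose_mul_self {κ ι : Type*} [Fintype κ] [Fintype ι] (M : Matrix κ ι ℂ) :
    (Mᴴ * M).trace.re = ∑ k, (star (fun i => M i k) ⬝ᵥ fun i => M i k).re := by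
  rw [trace, Complex.re_sum]
  rfl

variable {n m p : ℕ} {A : Matrix (Fin n) (Fin n) ℝ} {B : Matrix (Fin n) (Fin m) ℝ}
  {C : Matrix (Fin p) (Fin n) ℝ} {D : Matrix (Fin p) (Fin m) ℝ} {γ γ₀ : ℝ}

theorem IsHurwitz.eq_zero_of_conjTranspose_mulVec (hA : IsHurwitz A) {s : ℂ} (hs : 0 ≤ s.re)
    {x : Fin n → ℂ} (hx : (A.map (algebraMap ℝ ℂ))ᴴ *ᵥ x = star s • x) : x = 0 := by
  have hu : IsUnit (s • (1 : Matrix (Fin n) (Fin n) ℂ) - A.map (algebraMap ℝ ℂ))ᴴ := by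
    have := hA.isUnit hs
    rw [isUnit_iff_isUnit_det] at this ⊢
    rw [det_conjTranspose]
    exact this.star
  refine mulVec_injective_iff_isUnit.2 hu ?_
  simp only [conjTranspose_sub, conjTranspose_smul, conjTranspose_one, sub_mulVec, smul_mulVec,
    one_mulVec, hx, sub_self, mulVec_zero]

open scoped Matrix.Norms.L2Operator in
/-- The frequency-domain bound, for signals that decompose into purely imaginary frequencies. -/
theorem IsHurwitz.re_trace_output_le {ι : Type*} [Fintype ι] [DecidableEq ι] (hA : IsHurwitz A)
    (h : ∀ s : ℂ, 0 < s.re → ‖transferMatrix A B C D s‖ ≤ γ)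
    {F G : Matrix (Fin n) ι ℂ} {N : Matrix (Fin p) ι ℂ} {Y : Matrix (Fin m) ι ℂ}
    (hG : G = (A.map (algebraMap ℝ ℂ))ᴴ * F + (C.map (algebraMap ℝ ℂ))ᴴ * N)
    (hY : Y = (B.map (algebraMap ℝ ℂ))ᴴ * F + (D.map (algebraMap ℝ ℂ))ᴴ * N)
    (hGF : G * Fᴴ + F * Gᴴ = 0) :
    (Yᴴ * Y).trace.re ≤ γ ^ 2 * (Nᴴ * N).trace.re ∧ (N = 0 → F = 0) := by
  obtain ⟨P, V, ω, hP, hPP, hV, hFP, hGP⟩ := exists_projection_diagonalization hGF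
  -- Each column of F P V is an adjoint state at the frequency s = -iω, since `star s` = iω.
  have hstate : ∀ k, (A.map (algebraMap ℝ ℂ))ᴴ *ᵥ (fun i => (F * P * V) i k)
      + (C.map (algebraMap ℝ ℂ))ᴴ *ᵥ (fun i => (N * P * V) i k)
      = star (-((ω k : ℂ) * Complex.I)) • fun i => (F * P * V) i k := by
    intro k
    have e : (A.map (algebraMap ℝ ℂ))ᴴ * (F * P * V) + (C.map (algebraMap ℝ ℂ))ᴴ * (N * P * V)
        = F * P * V * diagonal (fun i => (ω i : ℂ) * Complex.I) := by
      rw [← hGP, hG]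
      simp only [Matrix.add_mul, Matrix.mul_assoc]
    ext i
    have e' := congrFun (congrFun e i) k
    rw [mul_diagonal, mul_comm] at e'
    refine Eq.trans e' ?_
    simp
  have hre : ∀ k, (-((ω k : ℂ) * Complex.I)).re = 0 := by simp
  refine ⟨?_, fun hN => ?_⟩
  · rw [trace_conjTranspose_mul_self_eq_add Y hP hPP hV,
      trace_conjTranspose_mul_self_eq_add N hP hPP hV, Complex.add_re, Complex.add_re, mul_add]
    simp only [re_trace_conjTranspose_mul_self, Finset.mul_sum]
    refine add_le_add (Finset.sum_le_sum fun k _ => ?_) (Finset.sum_le_sum fun k _ => ?_)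
    · have e : (fun i => (Y * P * V) i k) =
          (transferMatrix A B C D (-((ω k : ℂ) * Complex.I)))ᴴ *ᵥ fun i => (N * P * V) i k := by
        rw [conjTranspose_transferMatrix_mulVec (hA.isUnit (hre k).ge) (hstate k), hY]
        simp only [Matrix.add_mul, Matrix.mul_assoc]
        rfl
      rw [e]
      refine re_star_mulVec_dotProduct_le ?_ _
      rw [l2_opNorm_conjTranspose]
      exact norm_transferMatrix_le_of_re_eq_zero hA h (hre k)
    -- Since F (1 - P) = 0, these columns carry no state and only the feedthrough acts.
    · have e : (fun i => (Y * (1 - P) : Matrix _ _ ℂ) i k) =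
          (D.map (algebraMap ℝ ℂ))ᴴ *ᵥ fun i => (N * (1 - P) : Matrix _ _ ℂ) i k := by
        have : Y * (1 - P) = (D.map (algebraMap ℝ ℂ))ᴴ * (N * (1 - P)) := by
          rw [hY, Matrix.add_mul, Matrix.mul_assoc, Matrix.mul_sub F, hFP, Matrix.mul_one,
            sub_self, Matrix.mul_zero, zero_add, Matrix.mul_assoc]
        rw [this]
        rfl
      rw [e]
      refine re_star_mulVec_dotProduct_le ?_ _
      rw [l2_opNorm_conjTranspose]
      exact norm_feedthrough_le hA h
  -- Without input, a nonzero column would be an eigenvector of Aᴴ with imaginary eigenvalue.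
  · have h0 : F * P * V = 0 := by
      ext i k
      have := hstate k
      rw [hN, Matrix.zero_mul, Matrix.zero_mul] at this
      exact congrFun (hA.eq_zero_of_conjTranspose_mulVec (hre k).ge (by
        rw [← this]
        simp only [Matrix.zero_apply]
        exact ((congrArg _ (mulVec_zero _)).trans (add_zero _)).symm)) i
    rw [hFP] at h0
    rw [← Matrix.mul_one F, ← hV, ← Matrix.mul_assoc, h0, Matrix.zero_mul]

/-- The matrix of the quadratic form of the dissipation inequality. -/
def dissipationMatrix (A : Matrix (Fin n) (Fin n) ℝ) (B : Matrix (Fin n) (Fin m) ℝ)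
    (C : Matrix (Fin p) (Fin n) ℝ) (D : Matrix (Fin p) (Fin m) ℝ) (γ : ℝ)
    (R : Matrix (Fin n) (Fin n) ℝ) : Matrix (Fin n ⊕ Fin p) (Fin n ⊕ Fin p) ℝ :=
  (fromCols Aᵀ Cᵀ)ᵀ * R * fromCols (1 : Matrix (Fin n) (Fin n) ℝ) 0 + (fromCols (1 : Matrix (Fin n) (Fin n) ℝ) 0)ᵀ * R * fromCols Aᵀ Cᵀ
    + (fromCols Bᵀ Dᵀ)ᵀ * fromCols Bᵀ Dᵀ
    - γ ^ 2 • ((fromCols (0 : Matrix (Fin p) (Fin n) ℝ) (1 : Matrix (Fin p) (Fin p) ℝ))ᵀ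
      * fromCols (0 : Matrix (Fin p) (Fin n) ℝ) (1 : Matrix (Fin p) (Fin p) ℝ))

theorem dissipationMatrix_quadraticForm (A : Matrix (Fin n) (Fin n) ℝ)
    (B : Matrix (Fin n) (Fin m) ℝ) (C : Matrix (Fin p) (Fin n) ℝ) (D : Matrix (Fin p) (Fin m) ℝ)
    (γ : ℝ) {R : Matrix (Fin n) (Fin n) ℝ} (hR : R.IsSymm) (x : Fin n → ℝ) (u : Fin p → ℝ) :
    Sum.elim x u ⬝ᵥ dissipationMatrix A B C D γ R *ᵥ Sum.elim x u =
      2 * ((Aᵀ *ᵥ x + Cᵀ *ᵥ u) ⬝ᵥ (R *ᵥ x))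
      + (Bᵀ *ᵥ x + Dᵀ *ᵥ u) ⬝ᵥ (Bᵀ *ᵥ x + Dᵀ *ᵥ u) - γ ^ 2 * (u ⬝ᵥ u) := by
  have key : ∀ {k : ℕ} (J : Matrix (Fin k) (Fin n ⊕ Fin p) ℝ) (y : Fin k → ℝ),
      Sum.elim x u ⬝ᵥ Jᵀ *ᵥ y = (J *ᵥ Sum.elim x u) ⬝ᵥ y := fun J y => by
    rw [dotProduct_mulVec, vecMul_transpose]
  have hsymm : x ⬝ᵥ R *ᵥ (Aᵀ *ᵥ x + Cᵀ *ᵥ u) = (Aᵀ *ᵥ x + Cᵀ *ᵥ u) ⬝ᵥ (R *ᵥ x) := by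
    rw [dotProduct_mulVec, ← mulVec_transpose, hR.eq, dotProduct_comm]
  simp only [dissipationMatrix, sub_mulVec, add_mulVec, smul_mulVec, ← mulVec_mulVec, key,
    dotProduct_add, dotProduct_sub, dotProduct_smul, smul_eq_mul, fromCols_mulVec_sumElim,
    one_mulVec, zero_mulVec, add_zero, zero_add, hsymm]
  ring

theorem trace_dissipationMatrix {ι : Type*} [Fintype ι] (A : Matrix (Fin n) (Fin n) ℝ)
    (B : Matrix (Fin n) (Fin m) ℝ) (C : Matrix (Fin p) (Fin n) ℝ) (D : Matrix (Fin p) (Fin m) ℝ)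
    (γ : ℝ) (R : Matrix (Fin n) (Fin n) ℝ) (F : Matrix (Fin n) ι ℝ) (N : Matrix (Fin p) ι ℝ) :
    ((fromRows F N)ᵀ * dissipationMatrix A B C D γ R * fromRows F N).trace =
      (R * (F * (Aᵀ * F + Cᵀ * N)ᵀ + (Aᵀ * F + Cᵀ * N) * Fᵀ)).trace
      + ((Bᵀ * F + Dᵀ * N)ᵀ * (Bᵀ * F + Dᵀ * N)).trace - γ ^ 2 * (Nᵀ * N).trace := by
  have key : ∀ {k : ℕ} (J J' : Matrix (Fin k) (Fin n ⊕ Fin p) ℝ) (M : Matrix (Fin k) (Fin k) ℝ),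
      (fromRows F N)ᵀ * (Jᵀ * M * J') * fromRows F N
        = (J * fromRows F N)ᵀ * M * (J' * fromRows F N) := fun J J' M => by
    simp only [transpose_mul, Matrix.mul_assoc]
  have key' : ∀ {k : ℕ} (J J' : Matrix (Fin k) (Fin n ⊕ Fin p) ℝ),
      (fromRows F N)ᵀ * (Jᵀ * J') * fromRows F N
        = (J * fromRows F N)ᵀ * (J' * fromRows F N) := fun J J' => by
    simp only [transpose_mul, Matrix.mul_assoc]
  rw [dissipationMatrix]
  simp only [Matrix.mul_sub, Matrix.sub_mul, Matrix.mul_add, Matrix.add_mul, Matrix.mul_smul,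
    Matrix.smul_mul, key, key', fromCols_mul_fromRows, Matrix.one_mul, Matrix.zero_mul, add_zero,
    zero_add, trace_sub, trace_add, trace_smul, smul_eq_mul]
  congr 3
  · rw [trace_mul_comm, ← Matrix.mul_assoc, trace_mul_comm]
  · congr 1
    · rw [Matrix.mul_assoc, trace_mul_comm, Matrix.mul_assoc]
    · rw [Matrix.mul_assoc, trace_mul_comm, Matrix.mul_assoc]

open scoped Matrix.Norms.L2Operator in
/-- The strict bounded real lemma. -/
theorem IsHurwitz.exists_dissipationInequality (hA : IsHurwitz A)
    (h : ∀ s : ℂ, 0 < s.re → ‖transferMatrix A B C D s‖ ≤ γ₀) (hγ₀ : 0 ≤ γ₀) (hγ : γ₀ < γ) :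
    ∃ R : Matrix (Fin n) (Fin n) ℝ, R.IsSymm ∧ DissipationInequality A B C D R γ := by
  by_contra! hno
  obtain ⟨W, hW, hWt⟩ := exists_trace_nonneg_of_convex
    (t := dissipationMatrix A B C D γ '' {R | R.IsSymm}) (by
      rintro _ ⟨R, hR, rfl⟩ _ ⟨R', hR', rfl⟩ a b - - hab
      refine ⟨a • R + b • R', (hR.smul a).add (hR'.smul b), ?_⟩
      obtain rfl : b = 1 - a := by linarith
      simp only [dissipationMatrix, Matrix.mul_add, Matrix.add_mul, Matrix.mul_smul,
        Matrix.smul_mul]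
      module) ⟨_, 0, isSymm_zero, rfl⟩ (by
      rintro _ ⟨R, hR, rfl⟩
      have := hno R hR
      simp only [DissipationInequality, not_forall, not_le] at this
      obtain ⟨x, u, hxu⟩ := this
      refine ⟨Sum.elim x u, ?_⟩
      rw [dissipationMatrix_quadraticForm A B C D γ hR]
      linarith)
  obtain ⟨F, N, rfl⟩ : ∃ F N, W = fromRows F N := ⟨_, _, (fromRows_toRows W).symm⟩
  set G := Aᵀ * F + Cᵀ * N with hG
  set Y := Bᵀ * F + Dᵀ * N with hY
  have hWt' : ∀ R : Matrix (Fin n) (Fin n) ℝ, R.IsSymm →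
      0 ≤ (R * (F * Gᵀ + G * Fᵀ)).trace + (Yᵀ * Y).trace - γ ^ 2 * (Nᵀ * N).trace := by
    intro R hR
    have := hWt _ ⟨R, hR, rfl⟩
    rwa [trace_dissipationMatrix] at this
  -- An affine function of R bounded below has zero linear part. The multiple of T chosen below
  -- would give it the value c - |c| - 1 < 0.
  have hskew : F * Gᵀ + G * Fᵀ = 0 := by
    have hsymm : (F * Gᵀ + G * Fᵀ).IsSymm := by
      simp only [IsSymm, transpose_add, transpose_mul, transpose_transpose, add_comm]
    set T := F * Gᵀ + G * Fᵀ
    rw [← trace_conjTranspose_mul_self_eq_zero_iff, conjTranspose_eq_transpose_of_trivial,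
      hsymm.eq]
    have hnonneg : 0 ≤ (T * T).trace := by
      have := (posSemidef_conjTranspose_mul_self T).trace_nonneg
      rwa [conjTranspose_eq_transpose_of_trivial, hsymm.eq] at this
    set c := (Yᵀ * Y).trace - γ ^ 2 * (Nᵀ * N).trace
    by_contra hne
    have hpos : 0 < (T * T).trace := lt_of_le_of_ne hnonneg (Ne.symm hne)
    have := hWt' ((-((|c| + 1) / (T * T).trace)) • T) (hsymm.smul _)
    rw [Matrix.smul_mul, trace_smul, smul_eq_mul, neg_mul, div_mul_cancel₀ _ hpos.ne'] at this
    have := le_abs_self c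
    linarith
  have hYN : γ ^ 2 * (Nᵀ * N).trace ≤ (Yᵀ * Y).trace := by
    have := hWt' 0 isSymm_zero
    rw [Matrix.zero_mul, trace_zero] at this
    linarith
  have htr : ∀ {k : ℕ} (M : Matrix (Fin k) (Fin n ⊕ Fin p) ℝ),
      ((M.map (algebraMap ℝ ℂ))ᴴ * M.map (algebraMap ℝ ℂ)).trace.re = (Mᵀ * M).trace := by
    intro k M
    rw [conjTranspose_map_algebraMap, ← Matrix.map_mul]
    simp [trace]
  obtain ⟨h1, h2⟩ := hA.re_trace_output_le h (F := F.map (algebraMap ℝ ℂ))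
    (G := G.map (algebraMap ℝ ℂ)) (N := N.map (algebraMap ℝ ℂ)) (Y := Y.map (algebraMap ℝ ℂ))
    (by rw [hG, Matrix.map_add _ (map_add _), Matrix.map_mul, Matrix.map_mul,
          conjTranspose_map_algebraMap, conjTranspose_map_algebraMap])
    (by rw [hY, Matrix.map_add _ (map_add _), Matrix.map_mul, Matrix.map_mul,
          conjTranspose_map_algebraMap, conjTranspose_map_algebraMap])
    (by rw [conjTranspose_map_algebraMap, conjTranspose_map_algebraMap, ← Matrix.map_mul,
          ← Matrix.map_mul, ← Matrix.map_add _ (map_add _), add_comm, hskew]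
        exact Matrix.map_zero _ (map_zero _))
  rw [htr, htr] at h1
  have hN : N = 0 := by
    rw [← trace_conjTranspose_mul_self_eq_zero_iff, conjTranspose_eq_transpose_of_trivial]
    have hnonneg : 0 ≤ (Nᵀ * N).trace := by
      have := (posSemidef_conjTranspose_mul_self N).trace_nonneg
      rwa [conjTranspose_eq_transpose_of_trivial] at this
    -- Since γ² tr NᵀN ≤ tr YᵀY ≤ γ₀² tr NᵀN, the strict gap forces tr NᵀN = 0.
    have hlt : 0 < γ ^ 2 - γ₀ ^ 2 := by nlinarith
    nlinarith
  have hF : F.map (algebraMap ℝ ℂ) = 0 := h2 (by rw [hN]; exact Matrix.map_zero _ (map_zero _))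
  have hF' : F = 0 := by
    ext i j
    have := congrFun (congrFun hF i) j
    simpa using this
  apply hW
  rw [hN, hF', fromRows_zero]

end BoundedReal

/-! ### Application to the closed loop. -/

namespace Plant

variable {nx nw nu nz ny l : ℕ}

theorem neg_gLMI_add_gBMI (P : Plant nx nw nu nz ny) (E : Fin l → Matrix (Fin nu) (Fin ny) ℝ)
    {Q : Matrix (Fin nx) (Fin nx) ℝ} (hQ : Q.IsSymm) (h : Fin l → ℝ) (γ : ℝ) :
    -(P.gLMI Q γ + P.gBMI E Q h) =
      boundedRealMatrix (P.Acl E h) P.B₁ (P.Ccl E h) P.D₁₁ Q γ := by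
  have h0 : (0 : Matrix (Fin nz ⊕ Fin nw) (Fin nz ⊕ Fin nw) ℝ) = fromBlocks 0 0 0 0 :=
    fromBlocks_zero.symm
  rw [gLMI, gBMI, boundedRealMatrix, h0]
  simp only [fromBlocks_add, fromBlocks_neg, add_zero, neg_zero, neg_neg, Acl, Ccl,
    transpose_add, transpose_mul, hQ.eq, Matrix.add_mul, Matrix.mul_add, Matrix.mul_assoc]
  congr 3
  abel

theorem isFeasible_iff (P : Plant nx nw nu nz ny) (E : Fin l → Matrix (Fin nu) (Fin ny) ℝ)
    (Q : Matrix (Fin nx) (Fin nx) ℝ) (h : Fin l → ℝ) (γ : ℝ) :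
    P.IsFeasible E Q h γ ↔ Q.IsSymm ∧
      (boundedRealMatrix (P.Acl E h) P.B₁ (P.Ccl E h) P.D₁₁ Q γ).PosSemidef :=
  and_congr_right fun hQ => by rw [P.neg_gLMI_add_gBMI E hQ]

open scoped Matrix.Norms.L2Operator in
theorem closedLoopHInfNorm_le_ofReal_iff (P : Plant nx nw nu nz ny)
    (E : Fin l → Matrix (Fin nu) (Fin ny) ℝ) (hD₂₁ : P.D₂₁ = 0) (h : Fin l → ℝ) {γ : ℝ}
    (hγ : 0 ≤ γ) :
    P.closedLoopHInfNorm E h ≤ ENNReal.ofReal γ ↔ ∀ s : ℂ, 0 < s.re →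
      ‖transferMatrix (P.Acl E h) P.B₁ (P.Ccl E h) P.D₁₁ s‖ ≤ γ := by
  have hB : P.Bcl E h = P.B₁ := by rw [Bcl, hD₂₁, Matrix.mul_zero, add_zero]
  have hD : P.Dcl E h = P.D₁₁ := by rw [Dcl, hD₂₁, Matrix.mul_zero, add_zero]
  rw [closedLoopHInfNorm, hInfNorm, hB, hD]
  simp only [iSup_le_iff, ENNReal.ofReal_le_ofReal_iff hγ]

theorem exists_isFeasible_of_isStabilizing (P : Plant nx nw nu nz ny)
    (E : Fin l → Matrix (Fin nu) (Fin ny) ℝ) (hD₂₁ : P.D₂₁ = 0) {h : Fin l → ℝ}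
    (hstab : P.IsStabilizing E h) {γ₀ γ : ℝ} (hγ₀ : 0 ≤ γ₀)
    (hle : P.closedLoopHInfNorm E h ≤ ENNReal.ofReal γ₀) (hγ : γ₀ < γ) :
    ∃ Q, P.IsFeasible E Q h γ := by
  rw [P.closedLoopHInfNorm_le_ofReal_iff E hD₂₁ h hγ₀] at hle
  obtain ⟨R, hR, hdiss⟩ := IsHurwitz.exists_dissipationInequality hstab hle hγ₀ hγ
  -- Setting u = 0 in the dissipation inequality leaves a Lyapunov inequality.
  have hpos : R.PosSemidef := IsHurwitz.posSemidef_of_lyapunov hstab hR fun x => by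
    have h1 := hdiss x 0
    have h2 : 0 ≤ (P.B₁ᵀ *ᵥ x) ⬝ᵥ (P.B₁ᵀ *ᵥ x) := by
      simpa using dotProduct_star_self_nonneg (P.B₁ᵀ *ᵥ x)
    simp only [mulVec_zero, add_zero, dotProduct_zero, mul_zero] at h1
    linarith
  exact ⟨γ⁻¹ • R, (P.isFeasible_iff E _ _ _).2
    ⟨hR.smul _, hdiss.boundedRealMatrix_posSemidef (hγ₀.trans_lt hγ) hpos⟩⟩

end Plant

theorem proposition2 {nx nw nu nz ny l : ℕ} (P : Plant nx nw nu nz ny)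
    (E : Fin l → Matrix (Fin nu) (Fin ny) ℝ) (hE : ∀ i a b, E i a b = 0 ∨ E i a b = 1)
    (hD₂₁ : P.D₂₁ = 0) (hD₁₁ : P.D₁₁ ≠ 0) (hB₁ : (P.B₁ * P.B₁ᵀ).PosDef)
    (Q : Matrix (Fin nx) (Fin nx) ℝ) (h : Fin l → ℝ) (γ : ℝ)
    (hopt : P.IsOptimalSolution E Q h γ) :
    0 < γ ∧ P.IsHInfOptimal E h := by
  obtain ⟨hfeas, hmin⟩ := hopt
  obtain ⟨hQ, hbrl⟩ := (P.isFeasible_iff E Q h γ).1 hfeas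
  obtain ⟨i, j, hij⟩ : ∃ i j, P.D₁₁ i j ≠ 0 := by
    by_contra! h0
    exact hD₁₁ (Matrix.ext h0)
  have hγ : 0 < γ :=
    (abs_pos.2 hij).trans_le (abs_le_of_boundedRealMatrix_posSemidef hQ hbrl i j)
  have hdiss := dissipationInequality_of_boundedRealMatrix_posSemidef hQ hγ hbrl
  have hpos : (γ • Q).PosSemidef := (posSemidef_of_boundedRealMatrix_posSemidef hQ hbrl).smul hγ.le
  have hstab : P.IsStabilizing E h := hdiss.isHurwitz hpos hB₁
  refine ⟨hγ, hstab, fun h' hstab' => ?_⟩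
  refine ((P.closedLoopHInfNorm_le_ofReal_iff E hD₂₁ h hγ.le).2 fun s hs =>
    hdiss.norm_transferMatrix_le hγ.le hpos hstab hs).trans ?_
  by_contra! hlt
  obtain ⟨γ₁, hγ₁, hlt₁⟩ := ENNReal.lt_iff_exists_nnreal_btwn.1 hlt
  have hγ₁' : (γ₁ : ℝ) < γ := by
    rw [← ENNReal.ofReal_coe_nnreal, ENNReal.ofReal_lt_ofReal_iff hγ] at hlt₁
    exact hlt₁
  -- The midpoint of γ₁ and γ lies strictly above γ₁, as the strict lemma needs, and strictly below
  -- γ, against minimality.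
  obtain ⟨Q', hQ'⟩ := P.exists_isFeasible_of_isStabilizing E hD₂₁ hstab' γ₁.coe_nonneg
    (by rw [ENNReal.ofReal_coe_nnreal]; exact hγ₁.le) (left_lt_add_div_two.2 hγ₁')
  exact absurd (hmin Q' h' _ hQ') (not_le.2 (add_div_two_lt_right.2 hγ₁'))
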